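/- Let $(\mathbf{B},\|\cdot\|)$ be a real separable Banach space and let $\{Y_n;\ n\ge 1\}$ be a sequence of independent $\mathbf{B}$-valued random variables on a probability space. Let $\{Y_n';\ n\ge 1\}$ be an independent copy of $\{Y_n;\ n\ge 1\}$, that is, a sequence of random variables defined on the same probability space which has the same law as $\{Y_n;\ n\ge 1\}$ and is independent of it. Write $\hat Y_n = Y_n - Y_n'$, $n\ge 1$. Let $\{a_n;\ n\ge 1\}$ be an increasing (not necessarily strictly) sequence of positive real numbers such that $$\lim_{n\to\infty} a_n=\infty \quad\text{and}\quad \limsup_{n\to\infty}\mathbb{P}\left(\|Y_n\|>\frac{a_n}{2}\right)<\frac12 .$$ Then $$\frac{\sum_{i=1}^n Y_i}{a_n}\to 0\quad\text{a.s. (resp. in probability)}$$ if and only if $$\lim_{n\to\infty}\frac{\sum_{i=1}^n \mathbb{E}\left(Y_i I\{\|Y_i\|\le a_n\}\right)}{a_n}=0\quad\text{and}\quad \frac{\sum_{i=1}^n \hat Y_i}{a_n}\to 0\quad\text{a.s. (resp. in probability)}.$$ Here $I\{\cdot\}$ denotes the indicator of an event, and $\mathbb{E}$ of a $\mathbf{B}$-valued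 random variable is its Bochner integral. -/

import Mathlib

open MeasureTheory ProbabilityTheory Filter Topology

/-- The sequence `Y'` is an independent copy of the sequence `Y`: as random elements of the
sequence space `ℕ → B`, they have the same law and are independent of each other. -/
structure IsIndependentCopy {Ω B : Type*} [MeasurableSpace Ω] [MeasurableSpace B]
    (μ : Measure Ω) (Y Y' : ℕ → Ω → B) : Prop where
  measurable : ∀ n, Measurable (Y' n)
  identDistrib : IdentDistrib (fun ω n => Y n ω) (fun ω n => Y' n ω) μ μ
  indepFun : IndepFun (fun ω n => Y n ω) (fun ω n => Y' n ω) μ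

/-! Everything rests on one fact, `tendstoInMeasure_sum_sub_truncated_mean`: if the symmetrized
normalized sums vanish in probability, so do the sums centered at truncated means. The equivalence
in probability then follows by triangle inequalities. Almost surely, only the direction back to `Y`
needs more: `ae_tendsto_of_ae_tendsto_sub` freezes one copy by Fubini and uses convergence in
probability of the other along subsequences.

For the centering fact, Ottaviani's inequality makes all symmetrized partial sums small, hence the
summed tails of the differences. The limsup hypothesis keeps `Y' i` below `a n / 2` with probability
at least 1/2, so the tails of `Y` at `a n` are summably small as well and truncation at `a n` is
harmless. The truncated differences are bounded by `2 * a n`, so a Hoffmann-Jørgensen inequality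
upgrades smallness in probability to smallness in L¹. Jensen replaces the copy by the mean, and
Markov returns to probability. -/

/-! ### Maximal inequalities by first passage -/

section FirstPassage

variable {Ω B : Type*} {mΩ : MeasurableSpace Ω} {μ : Measure Ω}
  [NormedAddCommGroup B] [SecondCountableTopology B] [MeasurableSpace B] [BorelSpace B]
  {Z : ℕ → Ω → B}

/-- The `σ`-algebra generated by the variables `Z i`, `i ∈ S`. -/
abbrev sigmaOf (Z : ℕ → Ω → B) (S : Set ℕ) : MeasurableSpace Ω :=
  ⨆ i ∈ S, MeasurableSpace.comap (Z i) inferInstance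

/-- The event that the partial sums of `Z` exceed the level `s` in norm for the first time at
the index `j`. -/
def firstPassage (Z : ℕ → Ω → B) (s : ℝ) (j : ℕ) : Set Ω :=
  {ω | s < ‖∑ i ∈ Finset.range j, Z i ω‖} ∩
    ⋂ k ∈ Finset.range j, {ω | ‖∑ i ∈ Finset.range k, Z i ω‖ ≤ s}

omit [NormedAddCommGroup B] [SecondCountableTopology B] [BorelSpace B] in
lemma sigmaOf_le (hZ : ∀ i, Measurable (Z i)) (S : Set ℕ) : sigmaOf Z S ≤ mΩ :=
  iSup₂_le fun i _ => (hZ i).comap_le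

lemma measurable_sum_sigmaOf {S : Set ℕ} {s : Finset ℕ} (h : ∀ i ∈ s, i ∈ S) :
    Measurable[sigmaOf Z S] (fun ω => ∑ i ∈ s, Z i ω) := by
  refine Finset.measurable_fun_sum s fun i hi => ?_
  exact (comap_measurable (Z i)).mono
    (le_iSup₂_of_le (f := fun i _ => MeasurableSpace.comap (Z i) inferInstance) i (h i hi) le_rfl)
    le_rfl

lemma measurableSet_firstPassage_sigmaOf (s : ℝ) (j : ℕ) :
    MeasurableSet[sigmaOf Z (Set.Iio j)] (firstPassage Z s j) := by
  have hS : ∀ k ≤ j, Measurable[sigmaOf Z (Set.Iio j)]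
      (fun ω => ‖∑ i ∈ Finset.range k, Z i ω‖) := fun k hk =>
    measurable_norm.comp
      (measurable_sum_sigmaOf fun i hi => (Finset.mem_range.1 hi).trans_le hk)
  refine MeasurableSet.inter (hS j le_rfl measurableSet_Ioi) ?_
  refine Finset.measurableSet_biInter _ fun k hk => ?_
  exact hS k (Finset.mem_range.1 hk).le measurableSet_Iic

lemma measurableSet_firstPassage (hZ : ∀ i, Measurable (Z i)) (s : ℝ) (j : ℕ) :
    MeasurableSet (firstPassage Z s j) :=
  sigmaOf_le hZ _ _ (measurableSet_firstPassage_sigmaOf s j)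

omit [SecondCountableTopology B] [BorelSpace B] [MeasurableSpace B] in
lemma pairwise_disjoint_firstPassage (s : ℝ) :
    Pairwise (Function.onFun Disjoint (firstPassage Z s)) := by
  have key : ∀ i j, i < j → Disjoint (firstPassage Z s i) (firstPassage Z s j) := by
    intro i j hij
    rw [Set.disjoint_left]
    intro ω hi hj
    have h1 : s < ‖∑ l ∈ Finset.range i, Z l ω‖ := hi.1
    have h2 := Set.mem_iInter₂.1 hj.2 i (Finset.mem_range.2 hij)
    exact absurd h1 (not_lt.2 h2)
  intro i j hij
  rcases lt_or_gt_of_ne hij with h | h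
  · exact key i j h
  · exact (key j i h).symm

omit [SecondCountableTopology B] [BorelSpace B] [MeasurableSpace B] in
lemma biUnion_firstPassage (s : ℝ) (N : ℕ) :
    ⋃ j ∈ Finset.range (N + 1), firstPassage Z s j
      = {ω | ∃ j ≤ N, s < ‖∑ i ∈ Finset.range j, Z i ω‖} := by
  ext ω
  simp only [Set.mem_iUnion, Finset.mem_range, exists_prop, Set.mem_ofPred_eq]
  constructor
  · rintro ⟨j, hj, h⟩
    exact ⟨j, by omega, h.1⟩
  · rintro ⟨j, hj, h⟩
    classical
    have hex : ∃ j, s < ‖∑ i ∈ Finset.range j, Z i ω‖ := ⟨j, h⟩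
    have hle : Nat.find hex ≤ j := Nat.find_min' hex h
    refine ⟨Nat.find hex, by omega, Nat.find_spec hex, Set.mem_iInter₂.2 fun k hk => ?_⟩
    exact not_lt.1 (Nat.find_min hex (Finset.mem_range.1 hk))

variable [IsProbabilityMeasure μ]

lemma measureReal_exists_sum_lt (hZ : ∀ i, Measurable (Z i)) (s : ℝ) (N : ℕ) :
    μ.real {ω | ∃ j ≤ N, s < ‖∑ i ∈ Finset.range j, Z i ω‖}
      = ∑ j ∈ Finset.range (N + 1), μ.real (firstPassage Z s j) := by
  rw [← biUnion_firstPassage,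
    measureReal_biUnion_finset (fun i _ j _ hij => pairwise_disjoint_firstPassage s hij)
      (fun j _ => measurableSet_firstPassage hZ s j)]

omit [IsProbabilityMeasure μ] in
/-- The event of a first passage at `j` is independent of the increments after `j`. -/
lemma measureReal_firstPassage_inter (hZ : ∀ i, Measurable (Z i)) (hind : iIndepFun Z μ)
    (s : ℝ) (j N : ℕ) {D : Set B} (hD : MeasurableSet D) :
    μ.real (firstPassage Z s j ∩ {ω | ∑ i ∈ Finset.Ico j N, Z i ω ∈ D})
      = μ.real (firstPassage Z s j) * μ.real {ω | ∑ i ∈ Finset.Ico j N, Z i ω ∈ D} := by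
  have hI : Indep (sigmaOf Z (Set.Iio j)) (sigmaOf Z (Set.Ici j)) μ :=
    indep_iSup_of_disjoint (fun i => (hZ i).comap_le) hind.iIndep
      (Set.disjoint_left.2 fun i hi hi' => absurd (Set.mem_Iio.1 hi) (not_lt.2 (Set.mem_Ici.1 hi')))
  have h := (Indep_iff _ _ μ).1 hI _ _ (measurableSet_firstPassage_sigmaOf s j)
    (measurable_sum_sigmaOf (Z := Z) (S := Set.Ici j) (s := Finset.Ico j N)
      (fun i hi => (Finset.mem_Ico.1 hi).1) hD)
  simp only [measureReal_def]
  rw [← ENNReal.toReal_mul]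
  exact congrArg ENNReal.toReal h

/-- **Ottaviani's inequality**. -/
lemma ottaviani (hZ : ∀ i, Measurable (Z i)) (hind : iIndepFun Z μ) {N : ℕ} {s t q : ℝ}
    (hq : ∀ j ≤ N, μ.real {ω | t < ‖∑ i ∈ Finset.Ico j N, Z i ω‖} ≤ q) :
    (1 - q) * μ.real {ω | ∃ j ≤ N, s + t < ‖∑ i ∈ Finset.range j, Z i ω‖}
      ≤ μ.real {ω | s < ‖∑ i ∈ Finset.range N, Z i ω‖} := by
  have hD : MeasurableSet {x : B | ‖x‖ ≤ t} := measurable_norm measurableSet_Iic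
  have hC : ∀ j, MeasurableSet {ω | ∑ i ∈ Finset.Ico j N, Z i ω ∈ {x : B | ‖x‖ ≤ t}} :=
    fun j => (Finset.measurable_fun_sum _ fun i _ => hZ i) hD
  have hC' : ∀ j ≤ N, 1 - q ≤ μ.real {ω | ∑ i ∈ Finset.Ico j N, Z i ω ∈ {x : B | ‖x‖ ≤ t}} := by
    intro j hj
    have h1 := probReal_compl_eq_one_sub (μ := μ) (hC j)
    have h2 : {ω | ∑ i ∈ Finset.Ico j N, Z i ω ∈ {x : B | ‖x‖ ≤ t}}ᶜ
        = {ω | t < ‖∑ i ∈ Finset.Ico j N, Z i ω‖} := by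
      ext ω; simp
    rw [h2] at h1
    linarith [hq j hj]
  rw [measureReal_exists_sum_lt hZ, Finset.mul_sum]
  -- After a first passage at `j`, the independent remaining increment stays within `t` with
  -- probability at least `1 - q`.
  calc ∑ j ∈ Finset.range (N + 1), (1 - q) * μ.real (firstPassage Z (s + t) j)
      ≤ ∑ j ∈ Finset.range (N + 1), μ.real (firstPassage Z (s + t) j ∩
          {ω | ∑ i ∈ Finset.Ico j N, Z i ω ∈ {x : B | ‖x‖ ≤ t}}) := by
        refine Finset.sum_le_sum fun j hj => ?_
        rw [measureReal_firstPassage_inter hZ hind _ _ _ hD, mul_comm]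
        exact mul_le_mul_of_nonneg_left (hC' j (by have := Finset.mem_range.1 hj; omega))
          measureReal_nonneg
    _ = μ.real (⋃ j ∈ Finset.range (N + 1), firstPassage Z (s + t) j ∩
          {ω | ∑ i ∈ Finset.Ico j N, Z i ω ∈ {x : B | ‖x‖ ≤ t}}) := by
        rw [measureReal_biUnion_finset]
        · exact fun i _ j _ hij => (pairwise_disjoint_firstPassage (s + t) hij).mono
            Set.inter_subset_left Set.inter_subset_left
        · exact fun j _ => (measurableSet_firstPassage hZ _ j).inter (hC j)
    _ ≤ _ := by
        refine measureReal_mono (Set.iUnion₂_subset fun j hj ω hω => ?_)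
        have h1 : s + t < ‖∑ i ∈ Finset.range j, Z i ω‖ := hω.1.1
        have h2 : ‖∑ i ∈ Finset.Ico j N, Z i ω‖ ≤ t := hω.2
        have h3 := Finset.sum_range_add_sum_Ico (fun i => Z i ω)
          (show j ≤ N by have := Finset.mem_range.1 hj; omega)
        have h4 : ‖∑ i ∈ Finset.range j, Z i ω‖
            ≤ ‖∑ i ∈ Finset.range N, Z i ω‖ + ‖∑ i ∈ Finset.Ico j N, Z i ω‖ := by
          rw [← h3]
          simpa using norm_sub_le (∑ i ∈ Finset.range j, Z i ω + ∑ i ∈ Finset.Ico j N, Z i ω)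
            (∑ i ∈ Finset.Ico j N, Z i ω)
        show s < ‖∑ i ∈ Finset.range N, Z i ω‖
        linarith

/-- If the summands are bounded by `b`, then for the sum to exceed `s + t + b` it has to gain
more than `t` after the first passage over `s`. -/
lemma measureReal_sum_lt_le_of_bounded (hZ : ∀ i, Measurable (Z i)) (hind : iIndepFun Z μ)
    {N : ℕ} {s t q b : ℝ} (hs : 0 ≤ s) (ht : 0 ≤ t) (hb : 0 ≤ b) (hZb : ∀ i ω, ‖Z i ω‖ ≤ b)
    (hq : ∀ j ≤ N, μ.real {ω | t < ‖∑ i ∈ Finset.Ico j N, Z i ω‖} ≤ q) :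
    μ.real {ω | s + t + b < ‖∑ i ∈ Finset.range N, Z i ω‖}
      ≤ q * μ.real {ω | ∃ j ≤ N, s < ‖∑ i ∈ Finset.range j, Z i ω‖} := by
  have hD : MeasurableSet {x : B | t < ‖x‖} := measurable_norm measurableSet_Ioi
  rw [measureReal_exists_sum_lt hZ, Finset.mul_sum]
  calc _ ≤ μ.real (⋃ j ∈ Finset.range (N + 1), firstPassage Z s j ∩
          {ω | ∑ i ∈ Finset.Ico j N, Z i ω ∈ {x : B | t < ‖x‖}}) := by
        refine measureReal_mono (fun ω (hω : s + t + b < ‖∑ i ∈ Finset.range N, Z i ω‖) => ?_)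
          (measure_ne_top _ _)
        have hmem : ω ∈ ⋃ j ∈ Finset.range (N + 1), firstPassage Z s j := by
          rw [biUnion_firstPassage]
          exact ⟨N, le_rfl, by linarith⟩
        obtain ⟨j, hj, hjω⟩ := Set.mem_iUnion₂.1 hmem
        refine Set.mem_iUnion₂.2 ⟨j, hj, hjω, ?_⟩
        -- The overshoot at first passage is at most one summand; at `j = 0` the sum is empty.
        have hsj : ‖∑ i ∈ Finset.range j, Z i ω‖ ≤ s + b := by
          rcases j with _ | k
          · simpa using add_nonneg hs hb
          · have h1 : ‖∑ i ∈ Finset.range k, Z i ω‖ ≤ s :=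
              Set.mem_iInter₂.1 hjω.2 k (Finset.mem_range.2 k.lt_succ_self)
            rw [Finset.sum_range_succ]
            exact (norm_add_le _ _).trans (add_le_add h1 (hZb k ω))
        have h3 := Finset.sum_range_add_sum_Ico (fun i => Z i ω)
          (show j ≤ N by have := Finset.mem_range.1 hj; omega)
        have h4 := norm_add_le (∑ i ∈ Finset.range j, Z i ω) (∑ i ∈ Finset.Ico j N, Z i ω)
        rw [h3] at h4
        show t < ‖∑ i ∈ Finset.Ico j N, Z i ω‖
        linarith
    _ ≤ ∑ j ∈ Finset.range (N + 1), μ.real (firstPassage Z s j ∩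
          {ω | ∑ i ∈ Finset.Ico j N, Z i ω ∈ {x : B | t < ‖x‖}}) :=
        measureReal_biUnion_finset_le _ _
    _ ≤ _ := by
        refine Finset.sum_le_sum fun j hj => ?_
        rw [measureReal_firstPassage_inter hZ hind _ _ _ hD, mul_comm]
        exact mul_le_mul_of_nonneg_right (hq j (by have := Finset.mem_range.1 hj; omega))
          measureReal_nonneg

/-- A one-sided **Hoffmann-Jørgensen inequality** for sums of bounded independent variables. -/
lemma hoffmannJorgensen_tail (hZ : ∀ i, Measurable (Z i)) (hind : iIndepFun Z μ)
    {N : ℕ} {s t b : ℝ} (hs : 0 ≤ s) (ht : 0 ≤ t) (hb : 0 ≤ b) (hZb : ∀ i ω, ‖Z i ω‖ ≤ b)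
    (hq : ∀ j ≤ N, μ.real {ω | t < ‖∑ i ∈ Finset.Ico j N, Z i ω‖} ≤ 1 / 3) :
    μ.real {ω | s + (2 * t + b) < ‖∑ i ∈ Finset.range N, Z i ω‖}
      ≤ 1 / 2 * μ.real {ω | s < ‖∑ i ∈ Finset.range N, Z i ω‖} := by
  -- With `q = 1 / 3` the two inequalities combine to the factor `q / (1 - q) = 1 / 2`.
  have h1 := measureReal_sum_lt_le_of_bounded hZ hind (add_nonneg hs ht) ht hb hZb hq
  have h2 := ottaviani (s := s) hZ hind hq
  rw [show s + t + t + b = s + (2 * t + b) by ring] at h1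
  linarith

/-- Integrate the tail inequality over the level: the excess of the norm over `2 * t + b` has at
most half the mean of the norm. That mean is finite by boundedness, so the half can be absorbed. -/
lemma hoffmannJorgensen_integral (hZ : ∀ i, Measurable (Z i)) (hind : iIndepFun Z μ)
    {N : ℕ} {t b : ℝ} (ht : 0 ≤ t) (hb : 0 ≤ b) (hZb : ∀ i ω, ‖Z i ω‖ ≤ b)
    (hq : ∀ j ≤ N, μ.real {ω | t < ‖∑ i ∈ Finset.Ico j N, Z i ω‖} ≤ 1 / 3) :
    ∫ ω, ‖∑ i ∈ Finset.range N, Z i ω‖ ∂μ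
      ≤ 2 * ∫ ω, min ‖∑ i ∈ Finset.range N, Z i ω‖ (2 * t + b) ∂μ := by
  set U : Ω → ℝ := fun ω => ‖∑ i ∈ Finset.range N, Z i ω‖ with hU
  set A : ℝ := 2 * t + b with hA
  have hA0 : 0 ≤ A := by positivity
  have hUm : Measurable U := measurable_norm.comp (Finset.measurable_fun_sum _ fun i _ => hZ i)
  have hUint : Integrable U μ := by
    refine Integrable.of_bound hUm.aestronglyMeasurable (N * b) (ae_of_all _ fun ω => ?_)
    rw [hU, norm_norm]
    refine (norm_sum_le _ _).trans ((Finset.sum_le_sum fun i _ => hZb i ω).trans ?_)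
    simp
  have hMint : Integrable (fun ω => min (U ω) A) μ := hUint.inf (integrable_const A)
  set W : Ω → ℝ := fun ω => U ω - min (U ω) A with hW
  have hWint : Integrable W μ := hUint.sub hMint
  have hUnn : 0 ≤ᵐ[μ] U := ae_of_all _ fun ω => norm_nonneg _
  have hWnn : 0 ≤ᵐ[μ] W := ae_of_all _ fun ω => sub_nonneg.2 (min_le_left _ _)
  have hWU : ∫ ω, W ω ∂μ ≤ 1 / 2 * ∫ ω, U ω ∂μ := by
    rw [hWint.integral_eq_integral_meas_lt hWnn, hUint.integral_eq_integral_meas_lt hUnn,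
      ← integral_const_mul]
    have hUt : IntegrableOn (fun s => μ.real {ω | s < U ω}) (Set.Ioi 0) := by
      refine ⟨?_, ?_⟩
      · have : Antitone fun s => μ.real {ω | s < U ω} := fun x y hxy =>
          measureReal_mono fun ω (hω : y < U ω) => hxy.trans_lt hω
        exact this.measurable.aestronglyMeasurable
      · have h := lintegral_eq_lintegral_meas_lt μ hUnn hUm.aemeasurable
        have hfin : ∫⁻ ω, ENNReal.ofReal (U ω) ∂μ < ⊤ := by
          rw [← ofReal_integral_eq_lintegral_ofReal hUint hUnn]
          exact ENNReal.ofReal_lt_top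
        rw [h] at hfin
        refine lt_of_eq_of_lt ?_ hfin
        refine lintegral_congr fun s => ?_
        rw [Real.enorm_of_nonneg measureReal_nonneg]
        simp [measureReal_def]
    refine integral_mono_of_nonneg (ae_of_all _ fun s => measureReal_nonneg)
      (hUt.const_mul _) ?_
    refine (ae_restrict_iff' measurableSet_Ioi).2 (ae_of_all _ fun s hs => ?_)
    have hs0 : (0 : ℝ) < s := hs
    refine le_trans (measureReal_mono fun ω hω => ?_)
      (hoffmannJorgensen_tail hZ hind hs0.le ht hb hZb hq)
    have h1 : s < U ω - min (U ω) A := hω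
    rcases le_total (U ω) A with h | h
    · rw [min_eq_left h] at h1; linarith
    · rw [min_eq_right h] at h1
      show s + A < U ω
      linarith
  have hsub : ∫ ω, W ω ∂μ = ∫ ω, U ω ∂μ - ∫ ω, min (U ω) A ∂μ := integral_sub hUint hMint
  linarith

end FirstPassage

/-! ### Independent pairs and first hitting times -/

section Independence

variable {Ω β : Type*} {mΩ : MeasurableSpace Ω} {mβ : MeasurableSpace β} {μ : Measure Ω}
  [IsProbabilityMeasure μ]

omit [IsProbabilityMeasure μ] in
-- Rectangles form a generating π-system; on them, independence of the two families and then within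
-- each one factors the probability.
lemma ProbabilityTheory.iIndepFun.prodMk_of_indepFun {ι : Type*} {X X' : ι → Ω → β}
    (hXm : ∀ i, Measurable (X i)) (hXm' : ∀ i, Measurable (X' i))
    (hX : iIndepFun X μ) (hX' : iIndepFun X' μ)
    (h : IndepFun (fun ω i => X i ω) (fun ω i => X' i ω) μ) :
    iIndepFun (fun i ω => (X i ω, X' i ω)) μ := by
  classical
  set R : Set (Set (β × β)) :=
    Set.image2 (· ×ˢ ·) {s : Set β | MeasurableSet s} {t : Set β | MeasurableSet t} with hR
  refine iIndepSets.iIndep (fun i => ((hXm i).prodMk (hXm' i)).comap_le)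
    (fun i => (Set.preimage (fun ω => (X i ω, X' i ω))) '' R)
    (fun i => ?_) (fun i => ?_) ?_
  · exact isPiSystem_prod.comap _
  · rw [← MeasurableSpace.comap_generateFrom, generateFrom_prod]
  · rw [iIndepSets_iff]
    intro s f hf
    have hf' : ∀ i, ∃ A A' : Set β, MeasurableSet A ∧ MeasurableSet A' ∧
        (i ∈ s → f i = X i ⁻¹' A ∩ X' i ⁻¹' A') := by
      intro i
      by_cases hi : i ∈ s
      · obtain ⟨_, ⟨A, hA, A', hA', rfl⟩, hfi⟩ := hf i hi
        refine ⟨A, A', hA, hA', fun _ => hfi ▸ ?_⟩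
        ext ω; simp
      -- Off `s` the sets are arbitrary; they only make the choice total.
      · exact ⟨∅, ∅, .empty, .empty, fun h => absurd h hi⟩
    choose A A' hA hA' hfA using hf'
    have hpre : ∀ (V : ι → Ω → β) (D : ι → Set β),
        (⋂ i ∈ s, V i ⁻¹' D i) = (fun ω i => V i ω) ⁻¹' ((s : Set ι).pi D) := by
      intro V D; ext ω; simp [Set.mem_pi]
    have hmeas : ∀ D : ι → Set β, (∀ i, MeasurableSet (D i)) →
        MeasurableSet ((s : Set ι).pi D) := fun D hD =>
      MeasurableSet.pi s.countable_toSet fun i _ => hD i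
    have hone : ∀ i ∈ s, μ (f i) = μ (X i ⁻¹' A i) * μ (X' i ⁻¹' A' i) := by
      intro i hi
      rw [hfA i hi]
      exact (h.comp (measurable_pi_apply i) (measurable_pi_apply i)).measure_inter_preimage_eq_mul
        _ _ (hA i) (hA' i)
    calc μ (⋂ i ∈ s, f i)
        = μ ((⋂ i ∈ s, X i ⁻¹' A i) ∩ ⋂ i ∈ s, X' i ⁻¹' A' i) := by
          congr 1
          rw [Set.iInter₂_congr hfA]
          ext ω
          simp only [Set.mem_iInter, Set.mem_inter_iff]
          exact forall₂_and
      _ = (∏ i ∈ s, μ (X i ⁻¹' A i)) * ∏ i ∈ s, μ (X' i ⁻¹' A' i) := by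
          rw [← hX.measure_inter_preimage_eq_mul s fun i _ => hA i,
            ← hX'.measure_inter_preimage_eq_mul s fun i _ => hA' i, hpre, hpre]
          exact h.measure_inter_preimage_eq_mul _ _ (hmeas A hA) (hmeas A' hA')
      _ = ∏ i ∈ s, μ (f i) := by
          rw [← Finset.prod_mul_distrib]
          exact (Finset.prod_congr rfl hone).symm

/-- For independent variables, the sum of the probabilities of hitting `D` is controlled by the
probability that one of them hits `D`. -/
lemma sum_measureReal_preimage_le {X : ℕ → Ω → β} (hXm : ∀ i, Measurable (X i))
    (hX : iIndepFun X μ) {D : Set β} (hD : MeasurableSet D) (N : ℕ) {r : ℝ}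
    (hr : μ.real {ω | ∃ i < N, X i ω ∈ D} ≤ r) :
    (1 - r) * ∑ i ∈ Finset.range N, μ.real (X i ⁻¹' D) ≤ r := by
  -- `G i` says that no index before `i` hits `D`, so intersecting with a hit at `i` gives disjoint
  -- first-hit events.
  set G : ℕ → Set Ω := fun i => ⋂ k ∈ Finset.range i, X k ⁻¹' Dᶜ with hG
  have hGm : ∀ i, MeasurableSet (G i) := fun i =>
    Finset.measurableSet_biInter _ fun k _ => hXm k hD.compl
  have hGr : ∀ i ≤ N, 1 - r ≤ μ.real (G i) := by
    intro i hi
    have h1 : (G i)ᶜ ⊆ {ω | ∃ i < N, X i ω ∈ D} := by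
      intro ω hω
      by_contra hcon
      refine hω (Set.mem_iInter₂.2 fun k hk hkD => hcon ⟨k, ?_, hkD⟩)
      exact (Finset.mem_range.1 hk).trans_le hi
    have h2 := probReal_compl_eq_one_sub (μ := μ) (hGm i)
    have h3 : μ.real (G i)ᶜ ≤ r := (measureReal_mono h1).trans hr
    linarith
  have hprod : ∀ i, μ.real (X i ⁻¹' D ∩ G i) = μ.real (X i ⁻¹' D) * μ.real (G i) := by
    intro i
    classical
    have hG' : ∀ i, μ (G i) = ∏ k ∈ Finset.range i, μ (X k ⁻¹' Dᶜ) := fun i =>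
      hX.measure_inter_preimage_eq_mul (Finset.range i) fun _ _ => hD.compl
    have h := hX.measure_inter_preimage_eq_mul (Finset.range (i + 1))
      (sets := fun k => if k = i then D else Dᶜ)
      (fun k _ => by split_ifs; exacts [hD, hD.compl])
    have hset : ⋂ k ∈ Finset.range (i + 1), X k ⁻¹' (if k = i then D else Dᶜ)
        = X i ⁻¹' D ∩ G i := by
      rw [Finset.range_add_one, Finset.set_biInter_insert, if_pos rfl]
      congr 1
      exact Set.iInter₂_congr fun k hk => by rw [if_neg (Finset.mem_range.1 hk).ne]
    rw [hset, Finset.prod_range_succ, if_pos rfl, Finset.prod_congr rfl (g := fun k =>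
      μ (X k ⁻¹' Dᶜ)) (fun k hk => by rw [if_neg (Finset.mem_range.1 hk).ne]), ← hG',
      mul_comm] at h
    simp only [measureReal_def, h, ENNReal.toReal_mul]
  calc (1 - r) * ∑ i ∈ Finset.range N, μ.real (X i ⁻¹' D)
      ≤ ∑ i ∈ Finset.range N, μ.real (X i ⁻¹' D ∩ G i) := by
        rw [Finset.mul_sum]
        refine Finset.sum_le_sum fun i hi => ?_
        rw [hprod, mul_comm]
        exact mul_le_mul_of_nonneg_left (hGr i (Finset.mem_range.1 hi).le) measureReal_nonneg
    _ = μ.real (⋃ i ∈ Finset.range N, X i ⁻¹' D ∩ G i) := by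
        rw [measureReal_biUnion_finset]
        · have key : ∀ i j, i < j → Disjoint (X i ⁻¹' D ∩ G i) (X j ⁻¹' D ∩ G j) := fun i j hij =>
            Set.disjoint_left.2 fun ω h1 h2 =>
              Set.mem_iInter₂.1 h2.2 i (Finset.mem_range.2 hij) h1.1
          intro i _ j _ hij
          rcases lt_or_gt_of_ne hij with h | h
          exacts [key i j h, (key j i h).symm]
        · exact fun i _ => (hXm i hD).inter (hGm i)
    _ ≤ r := by
        refine (measureReal_mono ?_).trans hr
        exact Set.iUnion₂_subset fun i hi ω hω => ⟨i, Finset.mem_range.1 hi, hω.1⟩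

end Independence

/-! ### Removing an independent copy -/

section Symmetrization

variable {Ω B : Type*} {mΩ : MeasurableSpace Ω} {μ : Measure Ω} [IsProbabilityMeasure μ]
  [NormedAddCommGroup B] [SecondCountableTopology B] [MeasurableSpace B] [BorelSpace B]

/-- Centering at the mean costs at most as much as symmetrizing. -/
lemma integral_norm_sub_integral_le [NormedSpace ℝ B] [CompleteSpace B] {T T' : Ω → B}
    (hT : Measurable T) (hT' : Measurable T') (hint : Integrable T μ)
    (hid : IdentDistrib T T' μ μ) (hind : IndepFun T T' μ) :
    ∫ ω, ‖T ω - ∫ ω', T ω' ∂μ‖ ∂μ ≤ ∫ ω, ‖T ω - T' ω‖ ∂μ := by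
  have hint' : Integrable T' μ := hid.integrable_snd hint
  set m : B := ∫ ω', T ω' ∂μ with hm
  have hm' : m = ∫ y, y ∂(μ.map T') := by
    rw [hm, hid.integral_eq]
    exact (integral_map (f := fun y => y) hT'.aemeasurable aestronglyMeasurable_id).symm
  have hprob : IsProbabilityMeasure (μ.map T) := Measure.isProbabilityMeasure_map hT.aemeasurable
  have hprob' : IsProbabilityMeasure (μ.map T') :=
    Measure.isProbabilityMeasure_map hT'.aemeasurable
  have hid1 : Integrable (fun y : B => y) (μ.map T) :=
    (integrable_map_measure aestronglyMeasurable_id hT.aemeasurable).2 hint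
  have hid2 : Integrable (fun y : B => y) (μ.map T') :=
    (integrable_map_measure aestronglyMeasurable_id hT'.aemeasurable).2 hint'
  have hpint : Integrable (fun p : B × B => ‖p.1 - p.2‖) ((μ.map T).prod (μ.map T')) :=
    ((hid1.comp_fst _).sub (hid2.comp_snd _)).norm
  have hcont : Continuous fun p : B × B => ‖p.1 - p.2‖ := by fun_prop
  calc ∫ ω, ‖T ω - m‖ ∂μ = ∫ x, ‖x - m‖ ∂(μ.map T) := by
        rw [integral_map hT.aemeasurable]
        exact (continuous_id.sub continuous_const).norm.aestronglyMeasurable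
    _ ≤ ∫ x, ∫ y, ‖x - y‖ ∂(μ.map T') ∂(μ.map T) := by
        refine integral_mono (hid1.sub (integrable_const m)).norm hpint.integral_prod_left
          fun x => ?_
        -- The copy has mean `m`, so Jensen applies in the second variable.
        have h : x - m = ∫ y, (x - y) ∂(μ.map T') := by
          rw [integral_sub (integrable_const x) hid2, ← hm']
          simp
        simp only [h]
        exact norm_integral_le_integral_norm _
    _ = ∫ p, ‖p.1 - p.2‖ ∂((μ.map T).prod (μ.map T')) := (integral_prod _ hpint).symm
    _ = ∫ ω, ‖T ω - T' ω‖ ∂μ := by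
        rw [← hind.map_prod_eq_prod_map_map hT.aemeasurable hT'.aemeasurable,
          integral_map (hT.prodMk hT').aemeasurable hcont.aestronglyMeasurable]

/-- If `U - U'` converges to `0` almost surely, where `U'` is independent of `U` and converges to
`0` in probability, then `U` converges to `0` almost surely. -/
lemma ae_tendsto_of_ae_tendsto_sub {U U' : ℕ → Ω → B}
    (hU : ∀ n, Measurable (U n)) (hU' : ∀ n, Measurable (U' n))
    (hind : IndepFun (fun ω n => U n ω) (fun ω n => U' n ω) μ)
    (hsub : ∀ᵐ ω ∂μ, Tendsto (fun n => U n ω - U' n ω) atTop (𝓝 0))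
    (hlim : TendstoInMeasure μ U' atTop (fun _ => 0)) :
    ∀ᵐ ω ∂μ, Tendsto (fun n => U n ω) atTop (𝓝 0) := by
  have hUm : Measurable (fun ω n => U n ω) := measurable_pi_lambda _ hU
  have hUm' : Measurable (fun ω n => U' n ω) := measurable_pi_lambda _ hU'
  have hprob : IsProbabilityMeasure (μ.map fun ω n => U' n ω) :=
    Measure.isProbabilityMeasure_map hUm'.aemeasurable
  have hset : MeasurableSet {p : (ℕ → B) × (ℕ → B) |
      Tendsto (fun n => p.1 n - p.2 n) atTop (𝓝 0)} :=
    measurableSet_tendsto _ fun n =>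
      ((measurable_pi_apply n).comp measurable_fst).sub
        ((measurable_pi_apply n).comp measurable_snd)
  have h1 : ∀ᵐ p ∂(μ.map fun ω => ((fun n => U n ω), fun n => U' n ω)),
      Tendsto (fun n => p.1 n - p.2 n) atTop (𝓝 0) :=
    (ae_map_iff (hUm.prodMk hUm').aemeasurable hset).2 hsub
  rw [hind.map_prod_eq_prod_map_map hUm.aemeasurable hUm'.aemeasurable] at h1
  have h2 := ae_of_ae_map hUm.aemeasurable (Measure.ae_ae_of_ae_prod h1)
  filter_upwards [h2] with ω hω
  have h3 := ae_of_ae_map hUm'.aemeasurable hω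
  -- With `ω` fixed, a single good `ω'` for the copy settles each subsequence.
  refine tendsto_of_subseq_tendsto fun ns hns => ?_
  obtain ⟨ms, hms, hae⟩ := (hlim.comp hns).exists_seq_tendsto_ae
  obtain ⟨ω', h4, h5⟩ := (h3.and hae).exists
  refine ⟨ms, ?_⟩
  simpa using (h4.comp (hns.comp hms.tendsto_atTop)).add h5

end Symmetrization

/-! ### Tail bounds at the levels of the normalizing sequence -/

section Tails

variable {Ω B : Type*} {mΩ : MeasurableSpace Ω} {μ : Measure Ω} [IsProbabilityMeasure μ]
  [NormedAddCommGroup B] [MeasurableSpace B] [BorelSpace B]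

lemma tendsto_measureReal_lt_norm {f : Ω → B} (hf : Measurable f) :
    Tendsto (fun c : ℝ => μ.real {ω | c < ‖f ω‖}) atTop (𝓝 0) := by
  have hn : Measurable fun ω => ‖f ω‖ := measurable_norm.comp hf
  have hprob : IsProbabilityMeasure (μ.map fun ω => ‖f ω‖) :=
    Measure.isProbabilityMeasure_map hn.aemeasurable
  have h1 := tendsto_cdf_atTop (μ.map fun ω => ‖f ω‖)
  have h2 : ∀ c : ℝ, μ.real {ω | c < ‖f ω‖} = 1 - cdf (μ.map fun ω => ‖f ω‖) c := by
    intro c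
    rw [cdf_eq_real, map_measureReal_apply hn measurableSet_Iic,
      ← probReal_compl_eq_one_sub (hn measurableSet_Iic)]
    congr 1
    ext ω; simp
  simp only [h2]
  simpa using h1.const_sub 1

/-- A tail bound at the levels `c * a j`, for all large `j`, holds at the level `c * a n`
uniformly in `j ≤ n`, for all large `n`. -/
lemma eventually_forall_le_measureReal_lt_norm {f : ℕ → Ω → B} (hf : ∀ n, Measurable (f n))
    {a : ℕ → ℝ} (ha_mono : Monotone a) (ha_lim : Tendsto a atTop atTop) {c δ : ℝ} (hc : 0 < c)
    (hδ : 0 < δ) (h : ∀ᶠ n in atTop, μ.real {ω | c * a n < ‖f n ω‖} ≤ δ) :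
    ∀ᶠ n in atTop, ∀ j ≤ n, μ.real {ω | c * a n < ‖f j ω‖} ≤ δ := by
  obtain ⟨n₀, hn₀⟩ := eventually_atTop.1 h
  -- The finitely many early indices have vanishing tails because `a n → ∞`; for later ones
  -- monotonicity of `a` suffices.
  have h1 : ∀ᶠ n in atTop, ∀ j ∈ Finset.range n₀, μ.real {ω | c * a n < ‖f j ω‖} ≤ δ := by
    refine (eventually_all_finset _).2 fun j _ => ?_
    have h2 := (tendsto_measureReal_lt_norm (μ := μ) (hf j)).comp (ha_lim.const_mul_atTop hc)
    exact (h2.eventually (gt_mem_nhds hδ)).mono fun n hn => le_of_lt hn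
  filter_upwards [h1] with n hn j hj
  by_cases hjn : j < n₀
  · exact hn j (Finset.mem_range.2 hjn)
  · refine (measureReal_mono fun ω hω => ?_).trans (hn₀ j (not_lt.1 hjn))
    exact lt_of_le_of_lt (mul_le_mul_of_nonneg_left (ha_mono hj) hc.le) hω

omit [MeasurableSpace B] [BorelSpace B] in
lemma tendstoInMeasure_inv_smul_iff [NormedSpace ℝ B] {X : ℕ → Ω → B} {a : ℕ → ℝ}
    (ha : ∀ n, 0 < a n) :
    TendstoInMeasure μ (fun n ω => (a n)⁻¹ • X n ω) atTop (fun _ => 0) ↔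
      ∀ ε > 0, Tendsto (fun n => μ.real {ω | ε * a n < ‖X n ω‖}) atTop (𝓝 0) := by
  have hnorm : ∀ n ω, ‖(a n)⁻¹ • X n ω - 0‖ = ‖X n ω‖ / a n := fun n ω => by
    rw [sub_zero, norm_smul, norm_inv, Real.norm_of_nonneg (ha n).le, inv_mul_eq_div]
  simp only [tendstoInMeasure_iff_measureReal_norm, hnorm, le_div_iff₀ (ha _)]
  refine ⟨fun h ε hε => ?_, fun h ε hε => ?_⟩
  · refine squeeze_zero (fun n => measureReal_nonneg) (fun n => measureReal_mono fun ω hω => ?_)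
      (h ε hε)
    exact (show ε * a n < ‖X n ω‖ from hω).le
  · refine squeeze_zero (fun n => measureReal_nonneg) (fun n => measureReal_mono fun ω hω => ?_)
      (h (ε / 2) (half_pos hε))
    have h1 : ε * a n ≤ ‖X n ω‖ := hω
    have h2 := mul_pos hε (ha n)
    show ε / 2 * a n < ‖X n ω‖
    linarith

end Tails

/-! ### Consequences of small normalized sums -/

section NormalizedSums

variable {Ω B : Type*} {mΩ : MeasurableSpace Ω} {μ : Measure Ω} [IsProbabilityMeasure μ]
  [NormedAddCommGroup B] [SecondCountableTopology B] [MeasurableSpace B] [BorelSpace B]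
  {Z : ℕ → Ω → B} {a : ℕ → ℝ}

omit [SecondCountableTopology B] in
lemma measurableSet_lt_norm {f : Ω → B} (hf : Measurable f) (c : ℝ) :
    MeasurableSet {ω | c < ‖f ω‖} :=
  measurable_norm.comp hf measurableSet_Ioi

lemma eventually_measureReal_sum_range_le (hZ : ∀ i, Measurable (Z i)) (ha_pos : ∀ n, 0 < a n)
    (ha_mono : Monotone a) (ha_lim : Tendsto a atTop atTop)
    (hS : ∀ ε > 0, Tendsto
      (fun n => μ.real {ω | ε * a n < ‖∑ i ∈ Finset.range (n + 1), Z i ω‖}) atTop (𝓝 0))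
    {ε δ : ℝ} (hε : 0 < ε) (hδ : 0 < δ) :
    ∀ᶠ n in atTop, ∀ j ≤ n + 1,
      μ.real {ω | ε * a n < ‖∑ i ∈ Finset.range j, Z i ω‖} ≤ δ := by
  have h := eventually_forall_le_measureReal_lt_norm (μ := μ)
    (f := fun n ω => ∑ i ∈ Finset.range (n + 1), Z i ω)
    (fun n => Finset.measurable_fun_sum _ fun i _ => hZ i) ha_mono ha_lim hε hδ
    (((hS ε hε).eventually (gt_mem_nhds hδ)).mono fun n hn => le_of_lt hn)
  filter_upwards [h] with n hn j hj
  rcases j with _ | j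
  · simpa [not_lt.2 (mul_pos hε (ha_pos n)).le] using hδ.le
  · exact hn j (by omega)

lemma eventually_measureReal_sum_Ico_le (hZ : ∀ i, Measurable (Z i)) (ha_pos : ∀ n, 0 < a n)
    (ha_mono : Monotone a) (ha_lim : Tendsto a atTop atTop)
    (hS : ∀ ε > 0, Tendsto
      (fun n => μ.real {ω | ε * a n < ‖∑ i ∈ Finset.range (n + 1), Z i ω‖}) atTop (𝓝 0))
    {ε δ : ℝ} (hε : 0 < ε) (hδ : 0 < δ) :
    ∀ᶠ n in atTop, ∀ j ≤ n + 1,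
      μ.real {ω | ε * a n < ‖∑ i ∈ Finset.Ico j (n + 1), Z i ω‖} ≤ δ := by
  filter_upwards [eventually_measureReal_sum_range_le hZ ha_pos ha_mono ha_lim hS
    (half_pos hε) (half_pos hδ)] with n hn j hj
  calc μ.real {ω | ε * a n < ‖∑ i ∈ Finset.Ico j (n + 1), Z i ω‖}
      ≤ μ.real ({ω | ε / 2 * a n < ‖∑ i ∈ Finset.range (n + 1), Z i ω‖} ∪
          {ω | ε / 2 * a n < ‖∑ i ∈ Finset.range j, Z i ω‖}) := by
        refine measureReal_mono fun ω hω => ?_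
        have h1 : ε * a n < ‖∑ i ∈ Finset.Ico j (n + 1), Z i ω‖ := hω
        rw [Finset.sum_Ico_eq_sub _ hj] at h1
        have h2 := norm_sub_le (∑ i ∈ Finset.range (n + 1), Z i ω) (∑ i ∈ Finset.range j, Z i ω)
        by_contra hcon
        simp only [Set.mem_union, Set.mem_ofPred_eq, not_or, not_lt] at hcon
        linarith [hcon.1, hcon.2]
    _ ≤ δ := by
        refine (measureReal_union_le _ _).trans ?_
        linarith [hn (n + 1) le_rfl, hn j hj]

/-- If the normalized sums of independent variables converge to `0` in probability, the sums of
the tail probabilities of the summands converge to `0`. -/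
lemma eventually_sum_measureReal_le (hZ : ∀ i, Measurable (Z i)) (hind : iIndepFun Z μ)
    (ha_pos : ∀ n, 0 < a n) (ha_mono : Monotone a) (ha_lim : Tendsto a atTop atTop)
    (hS : ∀ ε > 0, Tendsto
      (fun n => μ.real {ω | ε * a n < ‖∑ i ∈ Finset.range (n + 1), Z i ω‖}) atTop (𝓝 0))
    {ε δ : ℝ} (hε : 0 < ε) (hδ : 0 < δ) :
    ∀ᶠ n in atTop, ∑ i ∈ Finset.range (n + 1), μ.real {ω | ε * a n < ‖Z i ω‖} ≤ δ := by
  -- Ottaviani with `s = t = ε / 4 * a n` bounds partial sums by `ε / 2 * a n`, and a summand is a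
  -- difference of two of them.
  have hε4 : 0 < ε / 4 := by positivity
  -- Writing `ρ` for this minimum, some summand is large with probability at most `2ρ ≤ 1 / 2`, so
  -- the tails sum to at most `4ρ ≤ δ`.
  have hρ : 0 < min (δ / 4) (1 / 4) := by positivity
  filter_upwards [eventually_measureReal_sum_Ico_le hZ ha_pos ha_mono ha_lim hS hε4
      one_half_pos, (hS _ hε4).eventually (gt_mem_nhds hρ)] with n hn hn'
  have h1 := ottaviani (s := ε / 4 * a n) hZ hind hn
  have h2 : μ.real {ω | ∃ i < n + 1, Z i ω ∈ {x : B | ε * a n < ‖x‖}}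
      ≤ 2 * min (δ / 4) (1 / 4) := by
    refine (measureReal_mono ?_).trans ((by linarith :
      μ.real {ω | ∃ j ≤ n + 1, ε / 4 * a n + ε / 4 * a n < ‖∑ i ∈ Finset.range j, Z i ω‖} ≤ _))
    rintro ω ⟨i, hi, hiω⟩
    by_contra hcon
    have h3 : ∀ j ≤ n + 1, ‖∑ i ∈ Finset.range j, Z i ω‖ ≤ ε / 4 * a n + ε / 4 * a n :=
      fun j hj => not_lt.1 fun h => hcon ⟨j, hj, h⟩
    have h4 : ε * a n < ‖Z i ω‖ := hiω
    have h5 := norm_sub_le (∑ k ∈ Finset.range (i + 1), Z k ω) (∑ k ∈ Finset.range i, Z k ω)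
    rw [Finset.sum_range_succ, add_sub_cancel_left, ← Finset.sum_range_succ] at h5
    linarith [h3 i hi.le, h3 (i + 1) hi]
  have h6 : (1 - 2 * min (δ / 4) (1 / 4)) *
      ∑ i ∈ Finset.range (n + 1), μ.real {ω | ε * a n < ‖Z i ω‖} ≤ 2 * min (δ / 4) (1 / 4) :=
    sum_measureReal_preimage_le hZ hind (measurable_norm measurableSet_Ioi) (n + 1) h2
  have h7 : 0 ≤ ∑ i ∈ Finset.range (n + 1), μ.real {ω | ε * a n < ‖Z i ω‖} :=
    Finset.sum_nonneg fun i _ => measureReal_nonneg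
  have h8 : min (δ / 4) (1 / 4) ≤ δ / 4 := min_le_left _ _
  have h9 : min (δ / 4) (1 / 4) ≤ 1 / 4 := min_le_right _ _
  nlinarith

/-- The capped norm in `hoffmannJorgensen_integral` is at most `η * c` off the tail event and `4 *
c` on it, so a small tail forces a small mean. -/
lemma integral_norm_le_of_measureReal_le {N : ℕ} {c : ℝ} (hZ : ∀ i, Measurable (Z i))
    (hind : iIndepFun Z μ) (hc : 0 ≤ c) (hZb : ∀ i ω, ‖Z i ω‖ ≤ 2 * c)
    (hq : ∀ j ≤ N, μ.real {ω | c < ‖∑ i ∈ Finset.Ico j N, Z i ω‖} ≤ 1 / 3) (η : ℝ) (hη : 0 ≤ η) :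
    ∫ ω, ‖∑ i ∈ Finset.range N, Z i ω‖ ∂μ
      ≤ 2 * (η * c + 4 * c * μ.real {ω | η * c < ‖∑ i ∈ Finset.range N, Z i ω‖}) := by
  refine (hoffmannJorgensen_integral hZ hind hc (by positivity) hZb hq).trans ?_
  set E : Set Ω := {ω | η * c < ‖∑ i ∈ Finset.range N, Z i ω‖} with hE
  have hEm : MeasurableSet E :=
    measurableSet_lt_norm (Finset.measurable_fun_sum _ fun i _ => hZ i) _
  have hηc : 0 ≤ η * c := mul_nonneg hη hc
  have h1 : ∫ ω, min ‖∑ i ∈ Finset.range N, Z i ω‖ (2 * c + 2 * c) ∂μ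
      ≤ ∫ ω, (η * c + E.indicator (fun _ => 4 * c) ω) ∂μ := by
    refine integral_mono_of_nonneg (ae_of_all _ fun ω => le_min (norm_nonneg _) (by positivity))
      ((integrable_const _).add ((integrable_const _).indicator hEm)) (ae_of_all _ fun ω => ?_)
    by_cases hω : ω ∈ E
    · simp only [Set.indicator_of_mem hω]
      exact (min_le_right _ _).trans (by linarith)
    · simp only [Set.indicator_of_notMem hω, add_zero]
      exact (min_le_left _ _).trans (not_lt.1 hω)
  rw [integral_add (integrable_const _) ((integrable_const _).indicator hEm),
    integral_indicator_const _ hEm] at h1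
  simp only [integral_const, probReal_univ, smul_eq_mul] at h1
  linarith

end NormalizedSums

/-! ### Truncation and its L¹ control -/

section Truncation

variable {Ω B : Type*} {mΩ : MeasurableSpace Ω} {μ : Measure Ω} [IsProbabilityMeasure μ]
  [NormedAddCommGroup B] [SecondCountableTopology B] [MeasurableSpace B] [BorelSpace B]
  {Y Y' : ℕ → Ω → B} {a : ℕ → ℝ}

/-- Truncation of a vector at the norm `c`. -/
noncomputable def truncNorm (c : ℝ) : B → B := Set.indicator {x | ‖x‖ ≤ c} id

omit [SecondCountableTopology B] [MeasurableSpace B] [BorelSpace B] in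
lemma truncNorm_of_le {c : ℝ} {x : B} (h : ‖x‖ ≤ c) : truncNorm c x = x :=
  Set.indicator_of_mem (s := {x : B | ‖x‖ ≤ c}) h id

omit [SecondCountableTopology B] in
lemma measurable_truncNorm (c : ℝ) : Measurable (truncNorm c : B → B) :=
  measurable_id.indicator (measurable_norm measurableSet_Iic)

omit [SecondCountableTopology B] [MeasurableSpace B] [BorelSpace B] in
lemma norm_truncNorm_le {c : ℝ} (hc : 0 ≤ c) (x : B) : ‖truncNorm c x‖ ≤ c := by
  by_cases h : ‖x‖ ≤ c
  · rwa [truncNorm_of_le h]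
  · have h0 : truncNorm c x = 0 := Set.indicator_of_notMem (s := {x : B | ‖x‖ ≤ c}) h id
    rwa [h0, norm_zero]

omit [SecondCountableTopology B] [IsProbabilityMeasure μ] in
lemma IsIndependentCopy.measureReal_lt_norm_eq (h : IsIndependentCopy μ Y Y') (i : ℕ) (c : ℝ) :
    μ.real {ω | c < ‖Y' i ω‖} = μ.real {ω | c < ‖Y i ω‖} :=
  congrArg ENNReal.toReal
    ((h.identDistrib.comp (measurable_pi_apply i)).measure_mem_eq
      (s := {x : B | c < ‖x‖}) (measurable_norm measurableSet_Ioi)).symm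

omit [NormedAddCommGroup B] [SecondCountableTopology B] [BorelSpace B] in
lemma IsIndependentCopy.iIndepFun (h : IsIndependentCopy μ Y Y') (hYm : ∀ n, Measurable (Y n))
    (hYind : iIndepFun Y μ) : ProbabilityTheory.iIndepFun Y' μ := by
  rw [iIndepFun_iff_map_fun_eq_infinitePi_map hYm] at hYind
  rw [iIndepFun_iff_map_fun_eq_infinitePi_map h.measurable, ← h.identDistrib.map_eq, hYind]
  congr 1
  funext i
  exact (h.identDistrib.comp (measurable_pi_apply i)).map_eq

omit [SecondCountableTopology B] in
/-- Symmetrization: the tail sums of `Y` are negligible if those of `Y - Y'` are. -/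
lemma eventually_sum_measureReal_le_of_sub (hYm : ∀ n, Measurable (Y n))
    (hY' : IsIndependentCopy μ Y Y') (ha_mono : Monotone a) (ha_lim : Tendsto a atTop atTop)
    (hlimsup : limsup (fun n => μ {ω | a n / 2 < ‖Y n ω‖}) atTop < (1 / 2 : ENNReal))
    (hsub : ∀ δ > 0, ∀ᶠ n in atTop,
      ∑ i ∈ Finset.range (n + 1), μ.real {ω | 1 / 2 * a n < ‖Y i ω - Y' i ω‖} ≤ δ)
    {δ : ℝ} (hδ : 0 < δ) :
    ∀ᶠ n in atTop, ∑ i ∈ Finset.range (n + 1), μ.real {ω | a n < ‖Y i ω‖} ≤ δ := by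
  -- This is where the limsup hypothesis enters.
  have hmed : ∀ᶠ n in atTop, μ.real {ω | 1 / 2 * a n < ‖Y n ω‖} ≤ 1 / 2 := by
    filter_upwards [eventually_lt_of_limsup_lt hlimsup] with n hn
    have h := ENNReal.toReal_mono (by simp) hn.le
    simpa [measureReal_def, div_eq_inv_mul] using h
  filter_upwards [eventually_forall_le_measureReal_lt_norm hYm ha_mono ha_lim one_half_pos
    one_half_pos hmed, hsub (δ / 2) (half_pos hδ)] with n hn hn'
  -- If `Y i` exceeds `a n` while the independent `Y' i` stays below `a n / 2`, the difference
  -- exceeds `a n / 2`.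
  have key : ∀ i ∈ Finset.range (n + 1), μ.real {ω | a n < ‖Y i ω‖}
      ≤ 2 * μ.real {ω | 1 / 2 * a n < ‖Y i ω - Y' i ω‖} := by
    intro i hi
    have hind : IndepFun (Y i) (Y' i) μ :=
      hY'.indepFun.comp (measurable_pi_apply i) (measurable_pi_apply i)
    have hA : MeasurableSet {x : B | a n < ‖x‖} := measurable_norm measurableSet_Ioi
    have hC : MeasurableSet {x : B | ‖x‖ ≤ 1 / 2 * a n} := measurable_norm measurableSet_Iic
    have h1 : μ.real (Y i ⁻¹' {x : B | a n < ‖x‖} ∩ Y' i ⁻¹' {x : B | ‖x‖ ≤ 1 / 2 * a n})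
        = μ.real {ω | a n < ‖Y i ω‖} * μ.real (Y' i ⁻¹' {x : B | ‖x‖ ≤ 1 / 2 * a n}) := by
      simp only [measureReal_def]
      rw [hind.measure_inter_preimage_eq_mul _ _ hA hC, ENNReal.toReal_mul]
      rfl
    have h2 : 1 / 2 ≤ μ.real (Y' i ⁻¹' {x : B | ‖x‖ ≤ 1 / 2 * a n}) := by
      have h3 := probReal_compl_eq_one_sub (μ := μ) (hY'.measurable i hC)
      have h4 : (Y' i ⁻¹' {x : B | ‖x‖ ≤ 1 / 2 * a n})ᶜ = {ω | 1 / 2 * a n < ‖Y' i ω‖} := by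
        ext ω; simp
      rw [h4, hY'.measureReal_lt_norm_eq] at h3
      linarith [hn i (by have := Finset.mem_range.1 hi; omega)]
    have h5 : μ.real (Y i ⁻¹' {x : B | a n < ‖x‖} ∩ Y' i ⁻¹' {x : B | ‖x‖ ≤ 1 / 2 * a n})
        ≤ μ.real {ω | 1 / 2 * a n < ‖Y i ω - Y' i ω‖} := by
      refine measureReal_mono fun ω hω => ?_
      have h6 : a n < ‖Y i ω‖ := hω.1
      have h7 : ‖Y' i ω‖ ≤ 1 / 2 * a n := hω.2
      have h8 := norm_sub_norm_le (Y i ω) (Y' i ω)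
      show 1 / 2 * a n < ‖Y i ω - Y' i ω‖
      linarith
    have h9 : 0 ≤ μ.real {ω | a n < ‖Y i ω‖} := measureReal_nonneg
    nlinarith
  refine (Finset.sum_le_sum key).trans ?_
  rw [← Finset.mul_sum]
  linarith

omit [SecondCountableTopology B] [MeasurableSpace B] [BorelSpace B] in
lemma measureReal_exists_lt_norm_le (N : ℕ) (c : ℝ) (X : ℕ → Ω → B) :
    μ.real {ω | ∃ i < N, c < ‖X i ω‖} ≤ ∑ i ∈ Finset.range N, μ.real {ω | c < ‖X i ω‖} := by
  refine (measureReal_mono ?_ (measure_ne_top _ _)).trans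
    (measureReal_biUnion_finset_le (Finset.range N) fun i => {ω | c < ‖X i ω‖})
  rintro ω ⟨i, hi, h⟩
  exact Set.mem_iUnion₂.2 ⟨i, Finset.mem_range.2 hi, h⟩

omit [SecondCountableTopology B] in
-- Truncation alters the sum only if some term of either sequence exceeds `c`. A general `F` serves
-- both the blocks and the full sum.
lemma measureReal_sum_truncNorm_sub_le (hY' : IsIndependentCopy μ Y Y') {N : ℕ} {F : Finset ℕ}
    (hF : ∀ i ∈ F, i < N) (c s : ℝ) :
    μ.real {ω | s < ‖∑ i ∈ F, (truncNorm c (Y i ω) - truncNorm c (Y' i ω))‖}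
      ≤ μ.real {ω | s < ‖∑ i ∈ F, (Y i ω - Y' i ω)‖}
        + 2 * ∑ i ∈ Finset.range N, μ.real {ω | c < ‖Y i ω‖} := by
  calc _ ≤ μ.real ({ω | s < ‖∑ i ∈ F, (Y i ω - Y' i ω)‖} ∪
          ({ω | ∃ i < N, c < ‖Y i ω‖} ∪ {ω | ∃ i < N, c < ‖Y' i ω‖})) := by
        refine measureReal_mono fun ω hω => ?_
        by_contra hcon
        simp only [Set.mem_union, Set.mem_ofPred_eq, not_or, not_exists, not_and, not_lt] at hcon
        obtain ⟨h1, h2, h3⟩ := hcon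
        refine not_lt.2 h1 ?_
        have h4 : s < ‖∑ i ∈ F, (truncNorm c (Y i ω) - truncNorm c (Y' i ω))‖ := hω
        rwa [Finset.sum_congr rfl fun i hi => by
          rw [truncNorm_of_le (h2 i (hF i hi)), truncNorm_of_le (h3 i (hF i hi))]] at h4
    _ ≤ _ := by
        refine (measureReal_union_le _ _).trans (add_le_add le_rfl ?_)
        refine (measureReal_union_le _ _).trans ?_
        rw [two_mul]
        refine add_le_add (measureReal_exists_lt_norm_le N c Y)
          ((measureReal_exists_lt_norm_le N c Y').trans_eq ?_)
        exact Finset.sum_congr rfl fun i _ => hY'.measureReal_lt_norm_eq i c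

/-- The symmetrized truncated sums are negligible in `L¹`. -/
lemma eventually_integral_norm_sum_truncNorm_sub_le
    (hYm : ∀ n, Measurable (Y n)) (hYind : iIndepFun Y μ)
    (hY' : IsIndependentCopy μ Y Y') (ha_pos : ∀ n, 0 < a n) (ha_mono : Monotone a)
    (ha_lim : Tendsto a atTop atTop)
    (hS : ∀ ε > 0, Tendsto (fun n => μ.real
      {ω | ε * a n < ‖∑ i ∈ Finset.range (n + 1), (Y i ω - Y' i ω)‖}) atTop (𝓝 0))
    (hp : ∀ δ > 0, ∀ᶠ n in atTop,
      ∑ i ∈ Finset.range (n + 1), μ.real {ω | a n < ‖Y i ω‖} ≤ δ)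
    {ε : ℝ} (hε : 0 < ε) :
    ∀ᶠ n in atTop, ∫ ω, ‖∑ i ∈ Finset.range (n + 1),
      (truncNorm (a n) (Y i ω) - truncNorm (a n) (Y' i ω))‖ ∂μ ≤ ε * a n := by
  have hYm' := hY'.measurable
  have hpair := iIndepFun.prodMk_of_indepFun hYm hYm' hYind (hY'.iIndepFun hYm hYind)
    hY'.indepFun
  -- Block tails total `1 / 6 + 2 / 12 = 1 / 3`, as Hoffmann-Jørgensen requires. The full tail is at
  -- most `ε / 32 + 2 * (ε / 64) = ε / 16`, giving mean at most `2 * (ε / 4 + 4 * (ε / 16)) * a n =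
  -- ε * a n`.
  filter_upwards [hp (1 / 12) (by norm_num), hp (ε / 64) (by positivity),
    eventually_measureReal_sum_Ico_le (Z := fun i ω => Y i ω - Y' i ω)
      (fun i => (hYm i).sub (hYm' i)) ha_pos ha_mono ha_lim hS
      one_pos (show (0 : ℝ) < 1 / 6 by norm_num),
    (hS (ε / 4) (by positivity)).eventually (gt_mem_nhds (show (0 : ℝ) < ε / 32 by positivity))]
    with n h1 h2 h3 h4
  have ha := (ha_pos n).le
  have hg : Measurable fun p : B × B => truncNorm (a n) p.1 - truncNorm (a n) p.2 :=
    ((measurable_truncNorm _).comp measurable_fst).sub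
      ((measurable_truncNorm _).comp measurable_snd)
  have h5 := integral_norm_le_of_measureReal_le (μ := μ) (N := n + 1)
    (Z := fun i ω => truncNorm (a n) (Y i ω) - truncNorm (a n) (Y' i ω))
    (fun i => hg.comp ((hYm i).prodMk (hYm' i))) (hpair.comp (fun _ => _) fun _ => hg) ha
    (fun i ω => (norm_sub_le _ _).trans (by
      linarith [norm_truncNorm_le ha (Y i ω), norm_truncNorm_le ha (Y' i ω)]))
    (fun j hj => by
      have h6 := measureReal_sum_truncNorm_sub_le hY' (N := n + 1) (F := Finset.Ico j (n + 1))
        (fun i hi => (Finset.mem_Ico.1 hi).2) (a n) (a n)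
      have h7 := h3 j hj
      rw [one_mul] at h7
      linarith) (ε / 4) (by positivity)
  have h8 := measureReal_sum_truncNorm_sub_le hY' (N := n + 1) (F := Finset.range (n + 1))
    (fun i hi => Finset.mem_range.1 hi) (a n) (ε / 4 * a n)
  have h9 := mul_le_mul_of_nonneg_left
    (h8.trans (show _ ≤ ε / 16 by linarith)) (show 0 ≤ 4 * a n by positivity)
  linarith

end Truncation

/-! ### Centering at truncated means -/

section Centering

variable {Ω B : Type*} {mΩ : MeasurableSpace Ω} {μ : Measure Ω} [IsProbabilityMeasure μ]
  [NormedAddCommGroup B] [NormedSpace ℝ B] [CompleteSpace B] [SecondCountableTopology B]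
  [MeasurableSpace B] [BorelSpace B] {Y Y' : ℕ → Ω → B} {a : ℕ → ℝ}

/-- If the symmetrized normalized sums converge to `0` in probability, so do the normalized sums
centered at the truncated means. -/
lemma tendstoInMeasure_sum_sub_truncated_mean
    (hYm : ∀ n, Measurable (Y n)) (hYind : iIndepFun Y μ)
    (hY' : IsIndependentCopy μ Y Y') (ha_pos : ∀ n, 0 < a n) (ha_mono : Monotone a)
    (ha_lim : Tendsto a atTop atTop)
    (hlimsup : limsup (fun n => μ {ω | a n / 2 < ‖Y n ω‖}) atTop < (1 / 2 : ENNReal))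
    (hS : TendstoInMeasure μ
      (fun n ω => (a n)⁻¹ • ∑ i ∈ Finset.range (n + 1), (Y i ω - Y' i ω)) atTop (fun _ => 0)) :
    TendstoInMeasure μ (fun n ω => (a n)⁻¹ • (∑ i ∈ Finset.range (n + 1), Y i ω -
      ∑ i ∈ Finset.range (n + 1), ∫ ω', truncNorm (a n) (Y i ω') ∂μ)) atTop (fun _ => 0) := by
  rw [tendstoInMeasure_inv_smul_iff ha_pos] at hS ⊢
  have hYm' := hY'.measurable
  have hpair := iIndepFun.prodMk_of_indepFun hYm hYm' hYind (hY'.iIndepFun hYm hYind)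
    hY'.indepFun
  have hsub : iIndepFun (fun i ω => Y i ω - Y' i ω) μ :=
    hpair.comp (fun _ p => p.1 - p.2) fun _ => measurable_fst.sub measurable_snd
  have hp : ∀ δ > 0, ∀ᶠ n in atTop,
      ∑ i ∈ Finset.range (n + 1), μ.real {ω | a n < ‖Y i ω‖} ≤ δ := fun δ hδ =>
    eventually_sum_measureReal_le_of_sub hYm hY' ha_mono ha_lim hlimsup
      (fun δ hδ => eventually_sum_measureReal_le (fun i => (hYm i).sub (hYm' i)) hsub ha_pos
        ha_mono ha_lim hS one_half_pos hδ) hδ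
  intro ε hε
  refine (tendsto_order.2 ⟨fun b hb => Eventually.of_forall fun n =>
    hb.trans_le measureReal_nonneg, fun δ hδ => ?_⟩)
  -- Truncation costs `δ / 4`; Markov at level `ε * a n` costs another `δ / 4`.
  filter_upwards [hp (δ / 4) (by positivity), eventually_integral_norm_sum_truncNorm_sub_le hYm
    hYind hY' ha_pos ha_mono ha_lim hS hp (show 0 < ε * (δ / 4) by positivity)] with n h1 h2
  have ha := (ha_pos n).le
  set T : Ω → B := fun ω => ∑ i ∈ Finset.range (n + 1), truncNorm (a n) (Y i ω) with hT
  set T' : Ω → B := fun ω => ∑ i ∈ Finset.range (n + 1), truncNorm (a n) (Y' i ω) with hT'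
  have hg : Measurable fun y : ℕ → B => ∑ i ∈ Finset.range (n + 1), truncNorm (a n) (y i) :=
    Finset.measurable_fun_sum _ fun i _ => (measurable_truncNorm _).comp (measurable_pi_apply i)
  have hTm : Measurable T := hg.comp (measurable_pi_lambda _ hYm)
  have hTm' : Measurable T' := hg.comp (measurable_pi_lambda _ hYm')
  have htint : ∀ i, Integrable (fun ω => truncNorm (a n) (Y i ω)) μ := fun i =>
    Integrable.of_bound ((measurable_truncNorm _).comp (hYm i)).aestronglyMeasurable (a n)
      (ae_of_all _ fun ω => norm_truncNorm_le ha _)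
  have hTint : Integrable T μ := integrable_finsetSum _ fun i _ => htint i
  have hmean : ∫ ω, T ω ∂μ = ∑ i ∈ Finset.range (n + 1), ∫ ω', truncNorm (a n) (Y i ω') ∂μ :=
    integral_finsetSum _ fun i _ => htint i
  have h3 : ∫ ω, ‖T ω - ∫ ω', T ω' ∂μ‖ ∂μ ≤ ε * (δ / 4) * a n := by
    refine (integral_norm_sub_integral_le hTm hTm' hTint (hY'.identDistrib.comp hg)
      (hY'.indepFun.comp hg hg)).trans (le_of_eq_of_le ?_ h2)
    simp only [hT, hT', Finset.sum_sub_distrib]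
  have h4 : ε * a n * μ.real {ω | ε * a n ≤ ‖T ω - ∫ ω', T ω' ∂μ‖} ≤ ε * (δ / 4) * a n :=
    (mul_meas_ge_le_integral_of_nonneg (ae_of_all _ fun ω => norm_nonneg _)
      (hTint.sub (integrable_const _)).norm _).trans h3
  have h5 : μ.real {ω | ε * a n ≤ ‖T ω - ∫ ω', T ω' ∂μ‖} ≤ δ / 4 := by
    refine le_of_mul_le_mul_left (h4.trans_eq ?_) (mul_pos hε (ha_pos n))
    ring
  rw [← hmean]
  calc μ.real {ω | ε * a n < ‖∑ i ∈ Finset.range (n + 1), Y i ω - ∫ ω', T ω' ∂μ‖}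
      ≤ μ.real ({ω | ∃ i < n + 1, a n < ‖Y i ω‖} ∪
          {ω | ε * a n ≤ ‖T ω - ∫ ω', T ω' ∂μ‖}) := by
        refine measureReal_mono fun ω hω => ?_
        by_contra hcon
        rw [Set.mem_union, not_or] at hcon
        obtain ⟨h6, h7⟩ := hcon
        have h8 : ∀ i ∈ Finset.range (n + 1), truncNorm (a n) (Y i ω) = Y i ω := fun i hi =>
          truncNorm_of_le (not_lt.1 fun h => h6 ⟨i, Finset.mem_range.1 hi, h⟩)
        have h9 : ε * a n < ‖∑ i ∈ Finset.range (n + 1), Y i ω - ∫ ω', T ω' ∂μ‖ := hω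
        refine h7 (show ε * a n ≤ ‖T ω - ∫ ω', T ω' ∂μ‖ from ?_)
        rw [show T ω = ∑ i ∈ Finset.range (n + 1), Y i ω from Finset.sum_congr rfl h8]
        exact h9.le
    _ ≤ δ / 4 + δ / 4 := (measureReal_union_le _ _).trans
        (add_le_add ((measureReal_exists_lt_norm_le _ _ _).trans h1) h5)
    _ < δ := by linarith

end Centering

/-! ### Elementary facts on convergence in probability -/

section ConvergenceInMeasure

variable {Ω B : Type*} {mΩ : MeasurableSpace Ω} {μ : Measure Ω} [IsProbabilityMeasure μ]
  [NormedAddCommGroup B]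

lemma tendstoInMeasure_zero_of_norm_le_add {f g h : ℕ → Ω → B}
    (hf : TendstoInMeasure μ f atTop (fun _ => 0)) (hg : TendstoInMeasure μ g atTop (fun _ => 0))
    (hle : ∀ n ω, ‖h n ω‖ ≤ ‖f n ω‖ + ‖g n ω‖) :
    TendstoInMeasure μ h atTop (fun _ => 0) := by
  simp only [tendstoInMeasure_iff_measureReal_norm, sub_zero] at hf hg ⊢
  intro ε hε
  have hlim := (hf (ε / 2) (half_pos hε)).add (hg (ε / 2) (half_pos hε))
  rw [add_zero] at hlim
  refine squeeze_zero (fun n => measureReal_nonneg) (fun n => ?_) hlim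
  refine (measureReal_mono fun ω hω => ?_).trans (measureReal_union_le _ _)
  have h1 : ε ≤ ‖h n ω‖ := hω
  by_contra hcon
  simp only [Set.mem_union, Set.mem_ofPred_eq, not_or, not_le] at hcon
  linarith [hcon.1, hcon.2, hle n ω]

lemma tendstoInMeasure_const_iff {c : ℕ → B} :
    TendstoInMeasure μ (fun n _ => c n) atTop (fun _ => 0) ↔ Tendsto c atTop (𝓝 0) := by
  refine ⟨fun h => tendsto_of_subseq_tendsto fun ns hns => ?_, fun h =>
    tendstoInMeasure_of_tendsto_ae (fun _ => aestronglyMeasurable_const) (ae_of_all _ fun _ => h)⟩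
  obtain ⟨ms, -, hms⟩ := (h.comp hns).exists_seq_tendsto_ae
  exact ⟨ms, hms.exists.choose_spec⟩

end ConvergenceInMeasure

/-! ### The two equivalences -/

theorem corollary3p1 {Ω B : Type*} [MeasurableSpace Ω] (μ : Measure Ω) [IsProbabilityMeasure μ]
    [NormedAddCommGroup B] [NormedSpace ℝ B] [CompleteSpace B]
    [TopologicalSpace.SeparableSpace B] [MeasurableSpace B] [BorelSpace B]
    (Y Y' : ℕ → Ω → B) (a : ℕ → ℝ)
    (hYm : ∀ n, Measurable (Y n)) (hYind : iIndepFun Y μ)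
    (hY' : IsIndependentCopy μ Y Y')
    (ha_pos : ∀ n, 0 < a n) (ha_mono : Monotone a) (ha_lim : Tendsto a atTop atTop)
    (hlimsup : limsup (fun n => μ {ω | a n / 2 < ‖Y n ω‖}) atTop < (1 / 2 : ENNReal)) :
    -- almost sure convergence
    ((∀ᵐ ω ∂μ, Tendsto (fun n => (a n)⁻¹ • ∑ i ∈ Finset.range (n + 1), Y i ω) atTop (𝓝 0)) ↔
      (Tendsto (fun n => (a n)⁻¹ • ∑ i ∈ Finset.range (n + 1),
          ∫ ω, Set.indicator {ω' | ‖Y i ω'‖ ≤ a n} (Y i) ω ∂μ) atTop (𝓝 0) ∧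
        ∀ᵐ ω ∂μ, Tendsto (fun n => (a n)⁻¹ • ∑ i ∈ Finset.range (n + 1), (Y i ω - Y' i ω))
          atTop (𝓝 0))) ∧
    -- convergence in probability
    (TendstoInMeasure μ (fun n ω => (a n)⁻¹ • ∑ i ∈ Finset.range (n + 1), Y i ω) atTop
        (fun _ => 0) ↔
      (Tendsto (fun n => (a n)⁻¹ • ∑ i ∈ Finset.range (n + 1),
          ∫ ω, Set.indicator {ω' | ‖Y i ω'‖ ≤ a n} (Y i) ω ∂μ) atTop (𝓝 0) ∧
        TendstoInMeasure μ (fun n ω => (a n)⁻¹ • ∑ i ∈ Finset.range (n + 1), (Y i ω - Y' i ω))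
          atTop (fun _ => 0))) := by
  have : SecondCountableTopology B := UniformSpace.secondCountable_of_separable B
  have hYm' := hY'.measurable
  set m : ℕ → B := fun n => (a n)⁻¹ • ∑ i ∈ Finset.range (n + 1),
    ∫ ω, Set.indicator {ω' | ‖Y i ω'‖ ≤ a n} (Y i) ω ∂μ with hm
  -- The normalized sum as a functional on sequence space, so equality of laws and independence of
  -- whole sequences transfer by composition.
  set G : ℕ → (ℕ → B) → B := fun n y => (a n)⁻¹ • ∑ i ∈ Finset.range (n + 1), y i with hG
  have hGm : ∀ n, Measurable (G n) := fun n =>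
    (Finset.measurable_fun_sum _ fun i _ => measurable_pi_apply i).const_smul _
  have hSm : ∀ n, Measurable fun ω => G n fun i => Y i ω := fun n =>
    (hGm n).comp (measurable_pi_lambda _ hYm)
  have hSm' : ∀ n, Measurable fun ω => G n fun i => Y' i ω := fun n =>
    (hGm n).comp (measurable_pi_lambda _ hYm')
  have hsub : ∀ n ω, G n (fun i => Y i ω - Y' i ω)
      = G n (fun i => Y i ω) - G n (fun i => Y' i ω) := fun n ω => by
    simp only [hG, Finset.sum_sub_distrib, smul_sub]
  have hDm : ∀ n, Measurable fun ω => G n fun i => Y i ω - Y' i ω := fun n => by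
    simp only [hsub]
    exact (hSm n).sub (hSm' n)
  have hcenter : TendstoInMeasure μ (fun n ω => G n fun i => Y i ω - Y' i ω) atTop
      (fun _ => 0) → TendstoInMeasure μ (fun n ω => G n (fun i => Y i ω) - m n) atTop
      (fun _ => 0) := fun h => by
    have h1 := tendstoInMeasure_sum_sub_truncated_mean hYm hYind hY' ha_pos ha_mono ha_lim
      hlimsup h
    simp only [smul_sub] at h1
    exact h1
  have hcopy : TendstoInMeasure μ (fun n ω => G n fun i => Y i ω) atTop (fun _ => 0) →
      TendstoInMeasure μ (fun n ω => G n fun i => Y' i ω) atTop (fun _ => 0) := fun h => by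
    simp only [tendstoInMeasure_iff_measureReal_norm, sub_zero] at h ⊢
    refine fun ε hε => (h ε hε).congr fun n => congrArg ENNReal.toReal ?_
    exact (hY'.identDistrib.comp (hGm n)).measure_mem_eq (s := {x : B | ε ≤ ‖x‖})
      (measurable_norm measurableSet_Ici)
  have hsymm : TendstoInMeasure μ (fun n ω => G n fun i => Y i ω) atTop (fun _ => 0) →
      TendstoInMeasure μ (fun n ω => G n fun i => Y i ω - Y' i ω) atTop (fun _ => 0) := fun h =>
    tendstoInMeasure_zero_of_norm_le_add h (hcopy h) fun n ω => by
      rw [hsub]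
      exact norm_sub_le _ _
  have hmean : TendstoInMeasure μ (fun n ω => G n fun i => Y i ω) atTop (fun _ => 0) →
      Tendsto m atTop (𝓝 0) := fun h =>
    (tendstoInMeasure_const_iff (μ := μ)).1 <|
      tendstoInMeasure_zero_of_norm_le_add h (hcenter (hsymm h)) fun n ω => by
        simpa using norm_sub_le (G n fun i => Y i ω) ((G n fun i => Y i ω) - m n)
  have hprob : Tendsto m atTop (𝓝 0) →
      TendstoInMeasure μ (fun n ω => G n fun i => Y i ω - Y' i ω) atTop (fun _ => 0) →
      TendstoInMeasure μ (fun n ω => G n fun i => Y i ω) atTop (fun _ => 0) := fun h1 h2 =>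
    tendstoInMeasure_zero_of_norm_le_add (hcenter h2) (tendstoInMeasure_const_iff.2 h1)
      fun n ω => by simpa using norm_add_le ((G n fun i => Y i ω) - m n) (m n)
  refine ⟨⟨fun h => ?_, fun ⟨h1, h2⟩ => ?_⟩, ⟨fun h => ⟨hmean h, hsymm h⟩, fun h => hprob h.1 h.2⟩⟩
  · refine ⟨hmean (tendstoInMeasure_of_tendsto_ae (fun n => (hSm n).aestronglyMeasurable) h), ?_⟩
    have h' : ∀ᵐ ω ∂μ, Tendsto (fun n => G n fun i => Y' i ω) atTop (𝓝 0) :=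
      hY'.identDistrib.ae_snd (p := fun y => Tendsto (fun n => G n y) atTop (𝓝 0))
        (measurableSet_tendsto _ hGm) h
    filter_upwards [h, h'] with ω hω hω'
    have h3 := hω.sub hω'
    rw [sub_zero] at h3
    exact h3.congr fun n => (hsub n ω).symm
  -- The equivalence in probability first supplies convergence in probability of the copy, which the
  -- Fubini argument needs.
  · have h3 := hprob h1 (tendstoInMeasure_of_tendsto_ae (fun n => (hDm n).aestronglyMeasurable) h2)
    have hGm' : Measurable fun (y : ℕ → B) n => G n y := measurable_pi_lambda _ hGm
    refine ae_tendsto_of_ae_tendsto_sub hSm hSm' (hY'.indepFun.comp hGm' hGm') ?_ (hcopy h3)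
    filter_upwards [h2] with ω hω
    exact hω.congr fun n => hsub n ω
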